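/- **Definitions.** "Regular cardinal" means infinite regular cardinal. For a (pre)ordered set $P$, the cofinality $\mathrm{cf}(P)$ is the least cardinality of a subset $Q\subseteq P$ such that every $x\in P$ satisfies $x\le y$ for some $y\in Q$. Let $T$ be a non-empty set, and let $I$ be a maximal (proper) ideal of the Boolean algebra of subsets of $T$. For linear orders $L_t$ ($t\in T$) and $f,g\in\prod_{t\in T}L_t$, put $f<_I g$ iff $\{t\in T:\neg(f(t)<g(t))\}\in I$, and $f=_I g$ iff $\{t\in T: f(t)\ne g(t)\}\in I$; the cofinality $\mathrm{cf}(\prod_{t}L_t,<_I)$ is taken with respect to the relation "$f<_I g$ or $f=_I g$". Let $\mathfrak a=\{\lambda_t:t\in T\}$ be a set of regular cardinals, given by a family indexed by $T$ (repetitions allowed), with $\lambda_t>|T|$ for each $t\in T$. Then $pcf(\mathfrak a)$ denotes the set of all cardinals of the form $\mathrm{cf}(\prod_{t\in T}L_t,<_I)$, where each $L_t$ is a linear order of cofinality $\lambda_t$ and $I$ is a maximal ideal of the Boolean algebra of subsets of $T$. **Theorem (the pcf theorem).** Let $\mathfrak a=\{\lambda_t:t\in T\}$ be as above, with $T\neq\emptyset$.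 Each cardinal $\lambda_t$ is regarded as a linear order, namely the well-ordered set of the ordinals below it. Then: 1. $pcf(\mathfrak a)$ is a set of regular cardinals, $\mathfrak a\subseteq pcf(\mathfrak a)$, and $|pcf(\mathfrak a)|\le 2^{|T|}$. 2. $pcf(\mathfrak a)$ has a largest element, denoted $\max pcf(\mathfrak a)$. 3. The cofinality of $\prod_{t\in T}\lambda_t$, partially ordered by $f\le g$ iff $f(t)\le g(t)$ for all $t\in T$, is $\max pcf(\mathfrak a)$. 4. For every $\theta\in pcf(\mathfrak a)$ there is a set $\mathfrak b_\theta\subseteq\mathfrak a$ such that, for this one choice of the sets $\mathfrak b_\theta$ and for every maximal ideal $I$ of the Boolean algebra of subsets of $T$, $$\mathrm{cf}\Bigl(\prod_{t\in T}\lambda_t,<_I\Bigr)=\min\bigl\{\theta\in pcf(\mathfrak a):\{t\in T:\lambda_t\in\mathfrak b_\theta\}\notin I\bigr\}.$$ -/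

import Mathlib

universe u

open Cardinal

namespace Pcf

/-- The product `∏ t, L t`, to be ordered modulo the ideal `I` of subsets of `T`. -/
def ProdMod {T : Type u} (L : T → Type u) (_I : Order.Ideal (Set T)) : Type u :=
  ∀ t, L t

/-- `f <_I g`: the set of `t` with `¬ f t < g t` belongs to `I`. -/
def LtMod {T : Type u} {L : T → Type u} [∀ t, LinearOrder (L t)] (I : Order.Ideal (Set T))
    (f g : ∀ t, L t) : Prop :=
  {t | ¬ f t < g t} ∈ I

/-- `f =_I g`: the set of `t` with `f t ≠ g t` belongs to `I`. -/
def EqMod {T : Type u} {L : T → Type u} (I : Order.Ideal (Set T)) (f g : ∀ t, L t) : Prop :=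
  {t | f t ≠ g t} ∈ I

/-- The order on `∏ t, L t` modulo a maximal ideal `I`. Its strict part is `<_I`, and `f ≤ g` means
that `f <_I g` or `f =_I g`. (Functions equal modulo `I` are not identified; this does not change
the cofinality.) -/
instance ProdMod.instPreorder {T : Type u} {L : T → Type u} [∀ t, LinearOrder (L t)]
    (I : Order.Ideal (Set T)) [I.IsMaximal] : Preorder (ProdMod L I) where
  le f g := LtMod I f g ∨ EqMod I f g
  lt f g := LtMod I f g
  le_refl f := Or.inr (by simpa [EqMod] using (Order.Ideal.bot_mem I))
  le_trans f g h := by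
    have key : ∀ {A B C : Set T}, A ∈ I → B ∈ I → C ⊆ A ∪ B → C ∈ I := fun hA hB h =>
      I.lower h (Order.Ideal.sup_mem hA hB)
    rintro (h1 | h1) (h2 | h2)
    · refine Or.inl (key h1 h2 fun t ht => ?_)
      by_contra hc
      simp only [Set.mem_union, Set.mem_ofPred_eq, not_or, not_not] at hc ht
      exact ht (hc.1.trans hc.2)
    · refine Or.inl (key h1 h2 fun t ht => ?_)
      by_contra hc
      simp only [Set.mem_union, Set.mem_ofPred_eq, not_or, not_not] at hc ht
      exact ht (hc.1.trans_eq hc.2)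
    · refine Or.inl (key h1 h2 fun t ht => ?_)
      by_contra hc
      simp only [Set.mem_union, Set.mem_ofPred_eq, not_or, not_not, ne_eq] at hc ht
      exact ht (hc.1.trans_lt hc.2)
    · refine Or.inr (key h1 h2 fun t ht => ?_)
      by_contra hc
      simp only [Set.mem_union, Set.mem_ofPred_eq, not_or, not_not, ne_eq] at hc ht
      exact ht (hc.1.trans hc.2)
  lt_iff_le_not_ge f g := by
    have hproper : ∀ {A B : Set T}, A ∈ I → B ∈ I → A ∪ B = Set.univ → False :=
      by
      intro A B hA hB h
      have hAB : A ∪ B ∈ I := Order.Ideal.sup_mem hA hB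
      rw [h] at hAB
      exact Order.Ideal.IsProper.top_notMem inferInstance hAB
    have hprime : ∀ A : Set T, A ∈ I ∨ Aᶜ ∈ I := fun A =>
      Order.Ideal.IsPrime.mem_or_compl_mem (I := I) inferInstance
    constructor
    · intro h
      refine ⟨Or.inl h, ?_⟩
      rintro (h' | h')
      · refine hproper h h' (Set.eq_univ_of_forall fun t => ?_)
        by_contra hc
        simp only [Set.mem_union, Set.mem_ofPred_eq, not_or, not_not] at hc
        exact lt_asymm hc.1 hc.2
      · refine hproper h h' (Set.eq_univ_of_forall fun t => ?_)
        by_contra hc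
        simp only [Set.mem_union, Set.mem_ofPred_eq, not_or, not_not, ne_eq] at hc
        exact hc.1.ne' hc.2
    · rintro ⟨h | h, hn⟩
      · exact h
      · exfalso
        refine hn (Or.inr ?_)
        have : {t | g t ≠ f t} = {t | f t ≠ g t} := Set.ext fun t => ne_comm
        change {t | g t ≠ f t} ∈ I
        rw [this]
        exact h

/-- For a family `lam` of cardinals indexed by `T`, the set of all cofinalities of `(∏ t, L t, <_I)`,
where each `L t` is a linear order of cofinality `lam t` and `I` is a maximal (proper) ideal of the
Boolean algebra of subsets of `T`. -/
def pcf {T : Type u} (lam : T → Cardinal.{u}) : Set Cardinal.{u} :=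
  {θ | ∃ (L : T → Type u) (_ : ∀ t, LinearOrder (L t)) (I : Order.Ideal (Set T)) (_ : I.IsMaximal),
    (∀ t, Order.cof (L t) = lam t) ∧ Order.cof (ProdMod L I) = θ}

/-- The cardinal `c` as a well-ordered set: a copy, in the universe of `c`, of the ordinals smaller
than the initial ordinal of `c`. -/
abbrev Carrier (c : Cardinal.{u}) : Type u := c.ord.ToType

end Pcf

/-!
A maximal ideal of subsets of `T` is the dual of an ultrafilter `U`, and the cofinality of an
ultraproduct depends only on `U` and on the cofinalities of the factors (`ucof_congr`), so `pcf lam`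
is the set of the cofinalities `ucof L U` for the one family `L t = Carrier (lam t)`. Instead of
working with the ideals `J_{<θ}` of the sets that belong to no `U` with `θ ≤ ucof L U`, the proof
quantifies over these ultrafilters (`LeAbove`).

Three facts carry the theorem.

* Directedness (`exists_leAbove_bound`): fewer than `θ` functions have a common upper bound modulo
  `J_{<θ}`.
* Universal families (`exists_universal`): `θ` functions suffice to be cofinal in all ultraproducts
  of cofinality `θ` at once.
* Generators (`exists_generator`): some set `B` belongs to every `U` with `ucof L U = θ`, and to no
  `U` with `ucof L U > θ`.

The first two are proved by iterating a counterexample `|T|⁺` times (taking `ℵ₀` for `|T|` if `T` is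
finite), which yields a strictly monotone chain of `|T|⁺` subsets of `T`. As the factors may have
cofinality `|T|⁺`, `|T|⁺⁺` or `|T|⁺⁺⁺`, cardinals up to this point are treated apart: the factors
have only finitely many cofinalities there, and an ultrafilter picks one of them. For generators one
starts from an increasing universal sequence, and needs that many of its initial segments are
bounded by later members jointly, off a single small set. Club guessing (`exists_clubGuessing`)
provides this without any assumption on `2 ^ |T|`.

Generators give the rest. An ultrafilter `U` contains the generator for `ucof L U`, and no
generator for a smaller cardinal, so `ucof L U` is the least cardinal whose generator lies in `U`;
saturating the generators makes them depend on `lam t` only (`exists_saturated_generator`).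
Distinct cofinalities have distinct generators, so there are at most `2 ^ |T|` of them. If there
were no largest cofinality, the complements of the generators would lie in a common ultrafilter,
which is absurd (`exists_forall_ucof_le`). Finally, finite suprema of members of the universal
families are cofinal in the full product (`cof_pi_eq_of_forall_ucof_le`).
-/

namespace Pcf

open Order Set Filter

/-! ### Well-orders and cofinalities -/

section WellOrder

/-- Transfinite recursion with a choice at every step. -/
theorem exists_forall_restrict {ι X : Type*} [Preorder ι] [WellFoundedLT ι]
    (P : ∀ i : ι, (Iio i → X) → X → Prop) (h : ∀ i p, ∃ x, P i p x) :
    ∃ g : ι → X, ∀ i, P i (fun j => g j) (g i) := by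
  choose F hF using h
  let g : ι → X := wellFounded_lt.fix fun i rec => F i fun j => rec j.1 j.2
  refine ⟨g, fun i => ?_⟩
  have : g i = F i fun j => g j := wellFounded_lt.fix_eq _ i
  rw [this]
  exact hF i _

theorem exists_forall_lt_of_mk_lt_cof {X : Type u} [LinearOrder X] {S : Set X}
    (hS : #S < Order.cof X) : ∃ x, ∀ s ∈ S, s < x :=
  not_isCofinal_iff.1 fun h => (cof_le h).not_gt hS

theorem exists_forall_range_lt_of_mk_lt_cof {X ι : Type u} [LinearOrder X] (f : ι → X)
    (hι : #ι < Order.cof X) : ∃ x, ∀ i, f i < x := by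
  obtain ⟨x, hx⟩ := exists_forall_lt_of_mk_lt_cof (mk_range_le.trans_lt hι : #(range f) < _)
  exact ⟨x, fun i => hx _ ⟨i, rfl⟩⟩

theorem cof_toType_ord_of_isRegular {c : Cardinal.{u}} (hc : c.IsRegular) :
    Order.cof c.ord.ToType = c := by
  rw [Ordinal.cof_toType, hc.cof_ord]

theorem noMaxOrder_toType_ord {c : Cardinal.{u}} (hc : ℵ₀ ≤ c) : NoMaxOrder c.ord.ToType := by
  have h := Cardinal.isSuccLimit_ord hc
  refine ⟨fun a => ?_⟩
  obtain ⟨⟨o, ho⟩, rfl⟩ := Ordinal.ToType.mk.surjective a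
  refine ⟨Ordinal.ToType.mk ⟨succ o, h.succ_lt ho⟩, ?_⟩
  simp

theorem nonempty_toType_ord {c : Cardinal.{u}} (hc : ℵ₀ ≤ c) : Nonempty c.ord.ToType := by
  rw [Ordinal.nonempty_toType_iff]
  simpa using (aleph0_pos.trans_le hc).ne'

/-- A total preorder has a monotone cofinal map from its cofinality, if that is infinite. -/
theorem exists_monotone_cofinal {X : Type u} [Preorder X] (htot : ∀ x y : X, x ≤ y ∨ y ≤ x)
    (hX : ℵ₀ ≤ Order.cof X) :
    ∃ k : (Order.cof X).ord.ToType → X, Monotone k ∧ ∀ x, ∃ i, x ≤ k i := by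
  have hbd : ∀ S : Set X, #S < Order.cof X → ∃ b, ∀ s ∈ S, s ≤ b := by
    intro S hS
    by_contra! hcon
    refine (cof_le (s := S) fun x => ?_).not_gt hS
    obtain ⟨s, hs, hsx⟩ := hcon x
    exact ⟨s, hs, (htot _ _).resolve_left hsx⟩
  obtain ⟨S, hS, hSc⟩ := exists_cof_eq X
  obtain ⟨e⟩ : Nonempty ((Order.cof X).ord.ToType ≃ S) := by
    rw [← Cardinal.eq, mk_toType, card_ord, hSc]
  obtain ⟨k, hk⟩ := exists_forall_restrict
    (fun (i : (Order.cof X).ord.ToType) (p : Iio i → X) x => (∀ j, p j ≤ x) ∧ (e i : X) ≤ x)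
    fun i p => by
      obtain ⟨b, hb⟩ := hbd (insert (e i : X) (range p)) <| by
        refine mk_insert_le.trans_lt (add_lt_of_lt hX ?_ (one_lt_aleph0.trans_le hX))
        exact mk_range_le.trans_lt (by simpa using mk_Iio_lt i)
      exact ⟨b, fun j => hb _ (Or.inr ⟨j, rfl⟩), hb _ (Or.inl rfl)⟩
  refine ⟨k, fun i j hij => ?_, fun x => ?_⟩
  · obtain rfl | hij := hij.eq_or_lt
    · exact le_rfl
    · exact (hk j).1 ⟨i, hij⟩
  · obtain ⟨s, hs, hxs⟩ := hS x
    refine ⟨e.symm ⟨s, hs⟩, hxs.trans ?_⟩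
    simpa using (hk (e.symm ⟨s, hs⟩)).2

theorem isRegular_cof_of_total {X : Type u} [Preorder X] (htot : ∀ x y : X, x ≤ y ∨ y ≤ x)
    (hX : ℵ₀ ≤ Order.cof X) : (Order.cof X).IsRegular := by
  obtain ⟨k, hk, hk'⟩ := exists_monotone_cofinal htot hX
  refine ⟨hX, ?_⟩
  rw [← Ordinal.cof_toType, le_cof_iff]
  intro s hs
  refine (cof_le (s := k '' s) fun x => ?_).trans mk_image_le
  obtain ⟨i, hi⟩ := hk' x
  obtain ⟨j, hj, hij⟩ := hs i
  exact ⟨k j, ⟨j, hj, rfl⟩, hi.trans (hk hij)⟩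

/-- An increasing chain of subsets of `T`, indexed by an order of cofinality larger than `#T`, is
eventually constant: every point enters the chain at some stage or never. -/
theorem exists_forall_ge_eq_of_monotone {T ι : Type u} [LinearOrder ι] (hι : #T < Order.cof ι)
    (B : ι → Set T) (hB : Monotone B) : ∃ a, ∀ b, a ≤ b → B b = B a := by
  classical
  have hne : Nonempty ι := by
    rw [← cof_ne_zero_iff]
    exact (bot_le.trans_lt hι).ne'
  have h : ∀ t : T, ∃ a, ∀ b, t ∈ B b → t ∈ B a := fun t => by
    by_cases ht : ∃ a, t ∈ B a
    · exact ⟨ht.choose, fun _ _ => ht.choose_spec⟩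
    · exact ⟨hne.some, fun b hb => (ht ⟨b, hb⟩).elim⟩
  choose s hs using h
  obtain ⟨a, ha⟩ := exists_forall_range_lt_of_mk_lt_cof s hι
  exact ⟨a, fun b hab => Subset.antisymm (fun t ht => hB (ha t).le (hs t b ht)) (hB hab)⟩

theorem exists_forall_ge_eq_of_antitone {T ι : Type u} [LinearOrder ι] (hι : #T < Order.cof ι)
    (B : ι → Set T) (hB : Antitone B) : ∃ a, ∀ b, a ≤ b → B b = B a := by
  obtain ⟨a, ha⟩ := exists_forall_ge_eq_of_monotone hι (fun i => (B i)ᶜ)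
    fun i j hij => compl_subset_compl.2 (hB hij)
  exact ⟨a, fun b hab => compl_injective (ha b hab)⟩

end WellOrder

/-! ### Normal functions and clubs -/

section Club

/-- Two normal functions with the same supremum agree on a club. -/
theorem isClub_setOf_eq_of_isNormal {K X : Type u} [LinearOrder K] [WellFoundedLT K] [NoMaxOrder K]
    [Nonempty K] [LinearOrder X] (hK : ℵ₀ < Order.cof K) {c e : K → X} (hc : IsNormal c)
    (he : IsNormal e) (hce : ∀ k, ∃ k', c k ≤ e k') (hec : ∀ k, ∃ k', e k ≤ c k') :
    IsClub {k | c k = e k} := by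
  refine ⟨fun s hs hs₀ _ a ha => ?_, fun a => ?_⟩
  · have h := hc.map_isLUB ha hs₀
    rw [image_congr hs] at h
    exact h.unique (he.map_isLUB ha hs₀)
  · have hstep : ∀ k, ∃ k', k ≤ k' ∧ c k ≤ e k' ∧ e k ≤ c k' := fun k => by
      obtain ⟨k₁, h₁⟩ := hce k
      obtain ⟨k₂, h₂⟩ := hec k
      refine ⟨max k (max k₁ k₂), le_max_left _ _, h₁.trans (he.monotone ?_),
        h₂.trans (hc.monotone ?_)⟩ <;> simp
    choose g hg using hstep
    let x : ℕ → K := fun n => g^[n] a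
    have hx : ∀ n, x (n + 1) = g (x n) := fun n => Function.iterate_succ_apply' g n a
    have hbd : BddAbove (range x) := by
      refine .of_not_isCofinal fun h => (cof_le h).not_gt (hK.trans_le' ?_)
      exact (countable_range x).le_aleph0
    obtain ⟨b, hb⟩ : ∃ b, IsLUB (range x) b :=
      ⟨wellFounded_lt.min _ hbd, wellFounded_lt.min_mem _ hbd,
        fun y hy => not_lt.1 (wellFounded_lt.not_lt_min _ hy)⟩
    refine ⟨b, ?_, hb.1 ⟨0, rfl⟩⟩
    have h₁ := hc.map_isLUB hb (range_nonempty x)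
    have h₂ := he.map_isLUB hb (range_nonempty x)
    refine le_antisymm (h₁.2 ?_) (h₂.2 ?_)
    · rintro _ ⟨_, ⟨n, rfl⟩, rfl⟩
      exact (hg (x n)).2.1.trans (h₂.1 ⟨_, ⟨n + 1, rfl⟩, by rw [hx]⟩)
    · rintro _ ⟨_, ⟨n, rfl⟩, rfl⟩
      exact (hg (x n)).2.2.trans (h₁.1 ⟨_, ⟨n + 1, rfl⟩, by rw [hx]⟩)

/-- A normal function that overtakes, at every step, a prescribed function of its own initial
segment. -/
theorem exists_isNormal_forall_lt_succ {M X : Type u} [LinearOrder M] [WellFoundedLT M]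
    [NoMaxOrder M] [SuccOrder M] [LinearOrder X] [WellFoundedLT X] [Nonempty X]
    (hMX : ∀ i : M, #(Iio i) < Order.cof X)
    (Q : M → (M → X) → X) (hQ : ∀ j g g', (∀ i ≤ j, g i = g' i) → Q j g = Q j g') :
    ∃ ξ : M → X, IsNormal ξ ∧ ∀ i, Q i ξ < ξ (succ i) := by
  classical
  obtain ⟨x₀⟩ := ‹Nonempty X›
  let ext : ∀ i : M, (Iio i → X) → M → X := fun i p j => if h : j < i then p ⟨j, h⟩ else x₀
  obtain ⟨ξ, hξ⟩ := exists_forall_restrict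
    (fun (i : M) (p : Iio i → X) x => IsLeast {x | ∀ j : Iio i, max (Q j (ext i p)) (p j) < x} x)
    fun i p => by
      have hne : {x | ∀ j : Iio i, max (Q j (ext i p)) (p j) < x}.Nonempty :=
        exists_forall_range_lt_of_mk_lt_cof _ (hMX i)
      exact ⟨wellFounded_lt.min _ hne, wellFounded_lt.min_mem _ hne,
        fun y hy => not_lt.1 (wellFounded_lt.not_lt_min _ hy)⟩
  have hξ' : ∀ i, IsLeast {x | ∀ j < i, max (Q j ξ) (ξ j) < x} (ξ i) := fun i => by
    have hext : ∀ j < i, Q j (ext i fun j => ξ j) = Q j ξ := fun j hj =>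
      hQ _ _ _ fun j' hj' => by simp [ext, hj'.trans_lt hj]
    have hset : {x | ∀ j < i, max (Q j ξ) (ξ j) < x} =
        {x | ∀ j : Iio i, max (Q j (ext i fun j => ξ j)) (ξ j) < x} := by
      ext x
      constructor
      · rintro h ⟨j, hj⟩
        rw [hext j hj]
        exact h j hj
      · intro h j hj
        rw [← hext j hj]
        exact h ⟨j, hj⟩
    rw [hset]
    exact hξ i
  have hlt : ∀ {j i}, j < i → max (Q j ξ) (ξ j) < ξ i := fun {j i} h => (hξ' i).1 j h
  refine ⟨ξ, isNormal_iff.2 ⟨fun j i h => (le_max_right _ _).trans_lt (hlt h), ?_⟩,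
    fun i => (le_max_left _ _).trans_lt (hlt (lt_succ i))⟩
  intro o ho a ha
  exact (hξ' o).2 fun j hj => (hlt (lt_succ j)).trans_le (ha _ (ho.succ_lt hj))

end Club

/-! ### Club guessing -/

section ClubGuessing

theorem isRegularCardinalOrder_toType_ord {c : Cardinal.{u}} (hc : c.IsRegular) :
    IsRegularCardinalOrder c.ord.ToType :=
  ⟨by rw [cof_toType_ord_of_isRegular hc, Ordinal.type_toType]⟩

theorem exists_isLUB_range_of_mk_lt_cof {X ι : Type u} [LinearOrder X] [WellFoundedLT X]
    (f : ι → X) (hι : #ι < Order.cof X) : ∃ x, IsLUB (range f) x := by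
  obtain ⟨b, hb⟩ := exists_forall_range_lt_of_mk_lt_cof f hι
  have hne : (upperBounds (range f)).Nonempty := ⟨b, by rintro _ ⟨i, rfl⟩; exact (hb i).le⟩
  exact ⟨wellFounded_lt.min _ hne, wellFounded_lt.min_mem _ hne,
        fun y hy => not_lt.1 (wellFounded_lt.not_lt_min _ hy)⟩

theorem exists_le_of_isLUB_range {K X : Type*} [LinearOrder K] [NoMaxOrder K] [LinearOrder X]
    {f g : K → X} {δ : X} (hf : StrictMono f) (hfδ : IsLUB (range f) δ) (hgδ : IsLUB (range g) δ)
    (k : K) : ∃ k', f k ≤ g k' := by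
  by_contra! hlt
  obtain ⟨k', hk'⟩ := exists_gt k
  refine ((hf hk').trans_le (hfδ.1 ⟨k', rfl⟩)).not_ge (hgδ.2 ?_)
  rintro _ ⟨i, rfl⟩
  exact (hlt i).le

/-- Club guessing, for a regular uncountable `κ` and a regular `μ > κ⁺`: some `μ` sets, each of them
so long that fewer than `κ` of its elements are bounded in it, guess every club of `μ`. The sets
are traces of one club `E` on arbitrarily chosen ladders of length `κ`. If no `E` worked, one could
shrink `E` at every step, for `κ⁺` steps, and the trace on some fixed ladder would shrink `κ⁺`
times, although the ladder has only `κ` elements. -/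
theorem exists_clubGuessing {κ μ : Cardinal.{u}} (hκ : κ.IsRegular) (hκ₀ : ℵ₀ < κ)
    (hμ : μ.IsRegular) (hκμ : succ κ < μ) :
    ∃ 𝒞 : μ.ord.ToType → Set μ.ord.ToType, ∀ E, IsClub E → ∃ δ, 𝒞 δ ⊆ E ∧
      ∀ s ⊆ 𝒞 δ, #s < κ → ∃ c ∈ 𝒞 δ, ∀ x ∈ s, x < c := by
  have hKc : Order.cof κ.ord.ToType = κ := cof_toType_ord_of_isRegular hκ
  have hMc : Order.cof μ.ord.ToType = μ := cof_toType_ord_of_isRegular hμ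
  have hAc : Order.cof (succ κ).ord.ToType = succ κ :=
    cof_toType_ord_of_isRegular (isRegular_succ hκ.aleph0_le)
  have hκμ' : κ < μ := (lt_succ κ).trans hκμ
  have := noMaxOrder_toType_ord hκ.aleph0_le
  have := nonempty_toType_ord hκ.aleph0_le
  have := isRegularCardinalOrder_toType_ord hμ
  have := noMaxOrder_toType_ord (isRegular_succ hκ.aleph0_le).aleph0_le
  let ladder : μ.ord.ToType → (κ.ord.ToType → μ.ord.ToType) → Prop := fun δ c =>
    IsNormal c ∧ IsLUB (range c) δ
  obtain ⟨c, hc⟩ : ∃ c : μ.ord.ToType → κ.ord.ToType → μ.ord.ToType,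
      ∀ δ, (∃ c', ladder δ c') → ladder δ (c δ) := by
    have : Nonempty μ.ord.ToType := nonempty_toType_ord hμ.aleph0_le
    exact ⟨fun δ => Classical.epsilon (ladder δ), fun δ h => Classical.epsilon_spec h⟩
  have key : ∃ E, IsClub E ∧ ∀ E', IsClub E' → ∃ δ, IsNormal (c δ) ∧
      IsCofinal {k | c δ k ∈ E} ∧ ∀ k, c δ k ∈ E → c δ k ∈ E' := by
    by_contra! hcon
    choose! next hnext hnext' using hcon
    obtain ⟨D, hD⟩ := exists_forall_restrict
      (fun (i : (succ κ).ord.ToType) (p : Iio i → Set μ.ord.ToType) x =>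
        x = ⋂ j, p j ∩ next (p j)) fun i p => ⟨_, rfl⟩
    have hDsub : ∀ {j i}, j < i → D i ⊆ D j ∩ next (D j) := fun {j i} hji => by
      rw [hD i]
      exact iInter_subset (fun j : Iio i => D j ∩ next (D j)) ⟨j, hji⟩
    have hℵ : Order.cof μ.ord.ToType ≠ ℵ₀ := by
      rw [hMc]; exact (hκ₀.trans hκμ').ne'
    have hDclub : ∀ i, IsClub (D i) := fun i => by
      induction i using WellFoundedLT.induction with
      | ind i ih =>
        rw [hD i]
        refine IsClub.iInter hℵ ?_ fun j => (ih j j.2).inter hℵ (hnext _ (ih j j.2))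
        rw [lift_id, lift_id, hMc]
        refine lt_trans ?_ hκμ
        simpa using mk_Iio_lt i
    have hDanti : Antitone D := fun i j hij => by
      obtain rfl | hij := hij.eq_or_lt
      · exact subset_rfl
      · exact (hDsub hij).trans inter_subset_left
    have hclub : IsClub (⋂ i, D i) := by
      refine IsClub.iInter hℵ ?_ hDclub
      rw [lift_id, lift_id, hMc]
      simpa using hκμ
    obtain ⟨seg⟩ : Nonempty (κ.ord.ToType ≤i μ.ord.ToType) := by
      rw [← Ordinal.type_le_iff, Ordinal.type_toType, Ordinal.type_toType]
      exact ord_le_ord.2 hκμ'.le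
    let e : κ.ord.ToType → μ.ord.ToType := (Subtype.val ∘ enum _ hclub.isCofinal) ∘ seg
    have he : IsNormal e := (IsClub.isNormal_enum hclub).comp seg.isNormal
    have heD : ∀ k i, e k ∈ D i := fun k i =>
      mem_iInter.1 (enum _ hclub.isCofinal (seg k)).2 i
    obtain ⟨δ, hδ⟩ := exists_isLUB_range_of_mk_lt_cof e (by rw [hMc]; simpa using hκμ')
    obtain ⟨hcn, hcδ⟩ := hc δ ⟨e, he, hδ⟩
    have hagree := isClub_setOf_eq_of_isNormal (by rw [hKc]; exact hκ₀) hcn he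
      (exists_le_of_isLUB_range hcn.strictMono hcδ hδ)
      (exists_le_of_isLUB_range he.strictMono hδ hcδ)
    obtain ⟨a, ha⟩ := exists_forall_ge_eq_of_antitone (T := κ.ord.ToType)
      (by rw [hAc]; simp) (fun i => {k | c δ k ∈ D i}) fun i j hij k hk => hDanti hij hk
    obtain ⟨k, hk, hk'⟩ := hnext' (D a) (hDclub a) δ hcn
      (hagree.isCofinal.mono fun k hk => by
        have : c δ k = e k := hk
        change c δ k ∈ D a
        rw [this]
        exact heD k a)
    obtain ⟨b, hab⟩ := exists_gt a
    refine hk' (hDsub hab ?_).2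
    have := ha b hab.le
    have hkb : k ∈ {k | c δ k ∈ D b} := by
      rw [this]
      exact hk
    exact hkb
  obtain ⟨E, hE, hE'⟩ := key
  refine ⟨fun δ => c δ '' {k | c δ k ∈ E}, fun E' h => ?_⟩
  obtain ⟨δ, hcn, hcof, hsub⟩ := hE' E' h
  refine ⟨δ, ?_, fun s hs hsκ => ?_⟩
  · rintro _ ⟨k, hk, rfl⟩
    exact hsub k hk
  · choose f hf hf' using fun x : s => hs x.2
    obtain ⟨k, hk⟩ := exists_forall_range_lt_of_mk_lt_cof f (by rwa [hKc])
    obtain ⟨k', hk', hkk'⟩ := hcof k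
    refine ⟨c δ k', ⟨k', hk', rfl⟩, fun x hx => ?_⟩
    exact (hf' ⟨x, hx⟩).symm.trans_lt (hcn.strictMono ((hk _).trans_le hkk'))

end ClubGuessing

/-! ### Cofinalities of ultraproducts -/

section Ultraproduct

/-- The product `∏ t, L t`, preordered by `f t ≤ g t` for `U`-almost all `t`. As for `ProdMod`,
functions that agree modulo `U` are not identified. -/
def UProd {T : Type u} (L : T → Type u) (_U : Ultrafilter T) : Type u := ∀ t, L t

instance UProd.instPreorder {T : Type u} {L : T → Type u} [∀ t, LinearOrder (L t)]
    (U : Ultrafilter T) : Preorder (UProd L U) where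
  le f g := ∀ᶠ t in U, f t ≤ g t
  le_refl _ := Eventually.of_forall fun _ => le_rfl
  le_trans _ _ _ h₁ h₂ := by filter_upwards [h₁, h₂] with t using le_trans

/-- The cofinality of the ultraproduct of the `L t` modulo `U`. -/
noncomputable def ucof {T : Type u} (L : T → Type u) [∀ t, LinearOrder (L t)] (U : Ultrafilter T) :
    Cardinal.{u} :=
  Order.cof (UProd L U)

variable {T : Type u} {L : T → Type u} [∀ t, LinearOrder (L t)] {U : Ultrafilter T}

theorem UProd.le_total (f g : UProd L U) : f ≤ g ∨ g ≤ f :=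
  Ultrafilter.eventually_or.1 (Eventually.of_forall fun t => _root_.le_total (f t) (g t))

/-- Functions are bounded pointwise, simultaneously at all `t` where the cofinality is large. -/
theorem exists_pointwise_bound {ι : Type u} [∀ t, Nonempty (L t)] (F : ι → ∀ t, L t) :
    ∃ g : ∀ t, L t, ∀ t, #ι < Order.cof (L t) → ∀ i, F i t < g t := by
  have h : ∀ t, ∃ x : L t, #ι < Order.cof (L t) → ∀ i, F i t < x := fun t => by
    by_cases ht : #ι < Order.cof (L t)
    · obtain ⟨x, hx⟩ := exists_forall_range_lt_of_mk_lt_cof (fun i => F i t) ht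
      exact ⟨x, fun _ => hx⟩
    · exact ⟨Classical.arbitrary _, fun h => (ht h).elim⟩
  choose g hg using h
  exact ⟨g, hg⟩

theorem exists_forall_eventually_lt_of_mk_lt_ucof {ι : Type u} [∀ t, NoMaxOrder (L t)]
    (F : ι → ∀ t, L t) (hι : #ι < ucof L U) : ∃ g : ∀ t, L t, ∀ i, ∀ᶠ t in U, F i t < g t := by
  have h : ¬ IsCofinal (range F : Set (UProd L U)) := fun h =>
    ((cof_le h).trans mk_range_le).not_gt hι
  simp only [IsCofinal, not_forall, not_exists, not_and] at h
  obtain ⟨g, hg⟩ := h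
  refine ⟨g, fun i => ?_⟩
  have := hg _ ⟨i, rfl⟩
  have := Ultrafilter.eventually_not.2 this
  filter_upwards [this] with t ht using not_le.1 ht

theorem le_ucof_of_forall_exists {χ : Cardinal.{u}}
    (h : ∀ S : Set (∀ t, L t), #S < χ → ∃ g : ∀ t, L t, ∀ f ∈ S, ∀ᶠ t in U, f t < g t) :
    χ ≤ ucof L U := by
  refine le_cof_iff.2 fun S hS => not_lt.1 fun hlt => ?_
  obtain ⟨g, hg⟩ := h S hlt
  obtain ⟨f, hf, hgf⟩ := hS g
  have hgf : ∀ᶠ t in U, g t ≤ f t := hgf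
  obtain ⟨t, h₁, h₂⟩ := (hgf.and (hg f hf)).exists
  exact h₁.not_gt h₂

theorem le_ucof {χ : Cardinal.{u}} [∀ t, Nonempty (L t)] (h : ∀ᶠ t in U, χ ≤ Order.cof (L t)) :
    χ ≤ ucof L U := by
  refine le_ucof_of_forall_exists fun S hS => ?_
  obtain ⟨g, hg⟩ := exists_pointwise_bound fun f : S => f.1
  refine ⟨g, fun f hf => ?_⟩
  filter_upwards [h] with t ht using hg t (hS.trans_le ht) ⟨f, hf⟩

theorem ucof_le {ι : Type u} (F : ι → ∀ t, L t)
    (hF : ∀ g : ∀ t, L t, ∃ i, ∀ᶠ t in U, g t ≤ F i t) : ucof L U ≤ #ι := by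
  refine (cof_le (α := UProd L U) (s := range F) fun g => ?_).trans mk_range_le
  obtain ⟨i, hi⟩ := hF g
  exact ⟨F i, ⟨i, rfl⟩, hi⟩

/-- For a regular `χ > #T`, some `χ` functions are cofinal at once in all ultraproducts that
concentrate on the factors of cofinality `χ`. -/
theorem exists_cofinal_of_cof_eq [∀ t, Nonempty (L t)] {χ : Cardinal.{u}} (hχ : χ.IsRegular)
    (hT : #T < χ) :
    ∃ k : χ.ord.ToType → ∀ t, L t, ∀ g : ∀ t, L t, ∃ i, ∀ t, Order.cof (L t) = χ → g t ≤ k i t := by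
  have h : ∀ t, ∃ k : χ.ord.ToType → L t, Order.cof (L t) = χ → Monotone k ∧ ∀ x, ∃ i, x ≤ k i := by
    intro t
    by_cases ht : Order.cof (L t) = χ
    · subst ht
      obtain ⟨k, hk⟩ := exists_monotone_cofinal (X := L t) le_total hχ.aleph0_le
      exact ⟨k, fun _ => hk⟩
    · exact ⟨fun _ => Classical.arbitrary _, fun h => (ht h).elim⟩
  choose k hk using h
  refine ⟨fun i t => k t i, fun g => ?_⟩
  have : Nonempty χ.ord.ToType := nonempty_toType_ord hχ.aleph0_le
  have h : ∀ t, ∃ i, Order.cof (L t) = χ → g t ≤ k t i := fun t => by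
    by_cases ht : Order.cof (L t) = χ
    · obtain ⟨i, hi⟩ := (hk t ht).2 (g t)
      exact ⟨i, fun _ => hi⟩
    · exact ⟨Classical.arbitrary _, fun h => (ht h).elim⟩
  choose s hs using h
  obtain ⟨i, hi⟩ := exists_forall_range_lt_of_mk_lt_cof s (by rwa [cof_toType_ord_of_isRegular hχ])
  exact ⟨i, fun t ht => (hs t ht).trans ((hk t ht).1 (hi t).le)⟩

variable [∀ t, NoMaxOrder (L t)] [∀ t, Nonempty (L t)]

theorem aleph0_le_ucof : ℵ₀ ≤ ucof L U :=
  le_ucof (Eventually.of_forall fun _ => aleph0_le_cof)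

theorem isRegular_ucof : (ucof L U).IsRegular :=
  isRegular_cof_of_total UProd.le_total aleph0_le_ucof

theorem isRegular_cof_of_noMaxOrder {X : Type u} [LinearOrder X] [NoMaxOrder X] [Nonempty X] :
    (Order.cof X).IsRegular :=
  isRegular_cof_of_total le_total aleph0_le_cof

theorem exists_ucof_scale : ∃ k : (ucof L U).ord.ToType → ∀ t, L t,
    (∀ i j, i ≤ j → ∀ᶠ t in U, k i t ≤ k j t) ∧ ∀ g : ∀ t, L t, ∃ i, ∀ᶠ t in U, g t ≤ k i t := by
  obtain ⟨k, hk, hk'⟩ := exists_monotone_cofinal (X := UProd L U) UProd.le_total aleph0_le_ucof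
  exact ⟨k, fun i j h => hk h, hk'⟩

theorem ucof_eq_of_eventually_cof_eq {χ : Cardinal.{u}} (hbig : ∀ t, #T < Order.cof (L t))
    (h : ∀ᶠ t in U, Order.cof (L t) = χ) : ucof L U = χ := by
  refine le_antisymm ?_ (le_ucof (h.mono fun _ ht => ht.ge))
  obtain ⟨t, rfl⟩ := h.exists
  obtain ⟨k, hk⟩ := exists_cofinal_of_cof_eq (L := L) (isRegular_cof_of_noMaxOrder (X := L t))
    (hbig t)
  refine (ucof_le k fun g => ?_).trans_eq (by simp)
  obtain ⟨i, hi⟩ := hk g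
  exact ⟨i, h.mono hi⟩

variable (T) in
/-- The length `κ` of the chains of subsets of `T` that the arguments rule out: the successor of
`max ℵ₀ #T`. -/
noncomputable def chainCard : Cardinal.{u} := succ (max ℵ₀ #T)

variable (T) in
/-- The least cardinal `μ` such that `μ` and `chainCard T` satisfy the assumptions of club
guessing. Cofinalities up to `μ` are treated separately. -/
noncomputable def guessCard : Cardinal.{u} := succ (succ (chainCard T))

theorem isRegular_chainCard : (chainCard T).IsRegular := isRegular_succ (le_max_left _ _)

theorem mk_lt_chainCard : #T < chainCard T := (le_max_right _ _).trans_lt (lt_succ _)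

theorem aleph0_lt_chainCard : ℵ₀ < chainCard T := (le_max_left _ _).trans_lt (lt_succ _)

theorem isRegular_guessCard : (guessCard T).IsRegular :=
  isRegular_succ (isRegular_succ isRegular_chainCard.aleph0_le).aleph0_le

theorem succ_chainCard_lt_guessCard : succ (chainCard T) < guessCard T := lt_succ _

theorem chainCard_lt_guessCard : chainCard T < guessCard T :=
  (lt_succ _).trans succ_chainCard_lt_guessCard

/-- The factors have only finitely many cofinalities up to `guessCard T`, so an ultrafilter that
concentrates on such factors concentrates on those of one cofinality. -/
theorem eventually_cof_eq_of_eventually_le {ν : Cardinal.{u}} (hbig : ∀ t, #T < Order.cof (L t))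
    (hν : ν ≤ guessCard T) (h : ∀ᶠ t in U, Order.cof (L t) ≤ ν) :
    ucof L U ≤ ν ∧ ∀ᶠ t in U, Order.cof (L t) = ucof L U := by
  have hlt : ∀ {a b : Cardinal.{u}}, a ≤ succ b → a = succ b ∨ a ≤ b := fun {a b} hab =>
    hab.eq_or_lt.imp_right lt_succ_iff.1
  have h4 : ∀ᶠ t in U, Order.cof (L t) = guessCard T ∨ Order.cof (L t) = succ (chainCard T) ∨
      Order.cof (L t) = chainCard T ∨ Order.cof (L t) = max ℵ₀ #T := by
    filter_upwards [h] with t ht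
    refine (hlt (ht.trans hν)).imp_right fun h => (hlt h).imp_right fun h =>
      (hlt h).imp_right fun h => h.antisymm ?_
    exact max_le aleph0_le_cof (hbig t).le
  have hex : ∃ χ, ∀ᶠ t in U, Order.cof (L t) = χ := by
    simp only [Ultrafilter.eventually_or] at h4
    rcases h4 with h | h | h | h <;> exact ⟨_, h⟩
  obtain ⟨χ, hχ⟩ := hex
  rw [ucof_eq_of_eventually_cof_eq hbig hχ]
  refine ⟨?_, hχ⟩
  obtain ⟨t, h₁, h₂⟩ := (hχ.and h).exists
  exact h₁ ▸ h₂

theorem eventually_lt_cof_of_lt_ucof {ν : Cardinal.{u}} (hbig : ∀ t, #T < Order.cof (L t))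
    (hν : ν ≤ guessCard T) (h : ν < ucof L U) : ∀ᶠ t in U, ν < Order.cof (L t) := by
  by_contra hcon
  have := Ultrafilter.eventually_not.2 hcon
  simp only [not_lt] at this
  exact (eventually_cof_eq_of_eventually_le hbig hν this).1.not_gt h

theorem eventually_cof_eq_of_ucof_eq {θ : Cardinal.{u}} (hbig : ∀ t, #T < Order.cof (L t))
    (hθ : θ ≤ guessCard T) (h : ucof L U = θ) : ∀ᶠ t in U, Order.cof (L t) = θ := by
  subst h
  refine (eventually_cof_eq_of_eventually_le hbig hθ ?_).2
  by_contra hcon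
  have := Ultrafilter.eventually_not.2 hcon
  refine (le_ucof (L := L) (χ := succ (ucof L U)) ?_).not_gt (lt_succ _)
  filter_upwards [this] with t ht using succ_le_of_lt (not_le.1 ht)

end Ultraproduct

/-! ### Directedness and universal families -/

section Directed

/-- `f ≤ g` modulo every ultrafilter whose ultraproduct has cofinality at least `θ`. In the usual
terminology this is `f ≤ g` modulo the ideal `J_{<θ}`. -/
def LeAbove {T : Type u} (L : T → Type u) [∀ t, LinearOrder (L t)] (θ : Cardinal.{u})
    (f g : ∀ t, L t) : Prop :=
  ∀ U : Ultrafilter T, θ ≤ ucof L U → ∀ᶠ t in U, f t ≤ g t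

variable {T : Type u} {L : T → Type u} [∀ t, LinearOrder (L t)] {θ : Cardinal.{u}}

theorem LeAbove.refl (f : ∀ t, L t) : LeAbove L θ f f :=
  fun _ _ => Eventually.of_forall fun _ => le_rfl

theorem LeAbove.trans {f g h : ∀ t, L t} (h₁ : LeAbove L θ f g) (h₂ : LeAbove L θ g h) :
    LeAbove L θ f h := fun U hU => by
  filter_upwards [h₁ U hU, h₂ U hU] with t using le_trans

variable [∀ t, NoMaxOrder (L t)] [∀ t, Nonempty (L t)]

/-- A long increasing chain is bounded modulo `J_{<θ}`. If `g` is not a bound, then some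
ultrafilter `U` refutes it; enlarge `g` to a bound of the chain modulo `U`, and iterate. If no bound
turned up in `chainCard T` steps, then for one sufficiently late member `f` of the chain the sets
`{t | g t < f t}` would shrink at every step. -/
theorem exists_leAbove_bound_of_chain {ι : Type u} [LinearOrder ι]
    (hbig : ∀ t, #T < Order.cof (L t)) (hι : chainCard T < Order.cof ι) (hιθ : #ι < θ)
    (h : ι → ∀ t, L t) (hh : ∀ i j, i ≤ j → LeAbove L θ (h i) (h j)) :
    ∃ g, ∀ i, LeAbove L θ (h i) g := by
  by_contra! hcon
  have hcon' : ∀ g : ∀ t, L t, ∃ i, ∃ U : Ultrafilter T, θ ≤ ucof L U ∧ ∀ᶠ t in U, g t < h i t := by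
    intro g
    obtain ⟨i, hi⟩ := hcon g
    simp only [LeAbove, not_forall] at hi
    obtain ⟨U, hU, hgU⟩ := hi
    refine ⟨i, U, hU, ?_⟩
    filter_upwards [Ultrafilter.eventually_not.2 hgU] with t ht using not_le.1 ht
  choose idx U hU hidx using hcon'
  have hN : ∀ g : ∀ t, L t, ∃ b : ∀ t, L t, ∀ j, ∀ᶠ t in U g, h j t < b t := fun g =>
    exists_forall_eventually_lt_of_mk_lt_ucof h (hιθ.trans_le (hU g))
  choose N hN using hN
  have hκθ : chainCard T < θ := (hι.trans_le (cof_le_cardinalMk ι)).trans hιθ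
  have hG : ∀ g, ∀ᶠ t in U g, chainCard T < Order.cof (L t) := fun g =>
    eventually_lt_cof_of_lt_ucof hbig chainCard_lt_guessCard.le (hκθ.trans_le (hU g))
  obtain ⟨g, hg⟩ := exists_forall_restrict
    (fun (α : (chainCard T).ord.ToType) (p : Iio α → ∀ t, L t) x =>
      ∀ t, chainCard T < Order.cof (L t) → ∀ β, max (p β t) (N (p β) t) < x t) fun α p => by
        obtain ⟨x, hx⟩ := exists_pointwise_bound fun β t => max (p β t) (N (p β) t)
        refine ⟨x, fun t ht => hx t (lt_trans ?_ ht)⟩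
        simpa using mk_Iio_lt α
  have hκc := cof_toType_ord_of_isRegular (isRegular_chainCard (T := T))
  obtain ⟨i, hi⟩ := exists_forall_range_lt_of_mk_lt_cof (fun α => idx (g α)) (by simpa using hι)
  let B : (chainCard T).ord.ToType → Set T := fun α =>
    {t | chainCard T < Order.cof (L t) ∧ g α t < h i t}
  obtain ⟨a, ha⟩ := exists_forall_ge_eq_of_antitone (hκc.symm ▸ mk_lt_chainCard) B
    fun α β hαβ t ht => by
      obtain rfl | hαβ := hαβ.eq_or_lt
      · exact ht
      · exact ⟨ht.1, ((le_max_left _ _).trans_lt (hg β t ht.1 ⟨α, hαβ⟩)).trans ht.2⟩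
  have := noMaxOrder_toType_ord (isRegular_chainCard (T := T)).aleph0_le
  obtain ⟨b, hab⟩ := exists_gt a
  have hmem : ∀ᶠ t in U (g a), t ∈ B b := by
    rw [ha b hab.le]
    filter_upwards [hG (g a), hidx (g a), hh _ _ (hi a).le (U (g a)) (hU _)] with t h₁ h₂ h₃
    exact ⟨h₁, h₂.trans_le h₃⟩
  obtain ⟨t, ⟨h₁, h₂⟩, h₃⟩ := (hmem.and (hN (g a) i)).exists
  exact lt_asymm (((le_max_right _ _).trans_lt (hg b t h₁ ⟨a, hab⟩)).trans h₂) h₃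

/-- The product is `θ`-directed modulo `J_{<θ}`. Inductively, bounds of the initial segments of a
well-ordered family form an increasing chain; it has a bound by the induction hypothesis if its
cofinality is small, and by `exists_leAbove_bound_of_chain` otherwise. -/
theorem exists_leAbove_bound (hbig : ∀ t, #T < Order.cof (L t)) {ι : Type u} (hι : #ι < θ)
    (F : ι → ∀ t, L t) : ∃ g, ∀ i, LeAbove L θ (F i) g := by
  induction hν : #ι using WellFoundedLT.induction generalizing ι with
  | ind ν ih =>
    obtain hκ | hκ := le_or_gt ν (chainCard T)
    · obtain ⟨g, hg⟩ := exists_pointwise_bound F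
      refine ⟨g, fun i U hU => ?_⟩
      filter_upwards [eventually_lt_cof_of_lt_ucof hbig (ν := ν)
        (hκ.trans chainCard_lt_guessCard.le) ((hν ▸ hι).trans_le hU)] with t ht
      exact (hg t (hν ▸ ht) i).le
    · have hν₀ : ℵ₀ ≤ ν := isRegular_chainCard.aleph0_le.trans hκ.le
      obtain ⟨e⟩ : Nonempty (ν.ord.ToType ≃ ι) := by
        rw [← Cardinal.eq, mk_toType, card_ord, hν]
      obtain ⟨h, hh⟩ := exists_forall_restrict
        (fun (i : ν.ord.ToType) (p : Iio i → ∀ t, L t) x =>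
          (∀ j, LeAbove L θ (p j) x) ∧ LeAbove L θ (F (e i)) x) fun i p => by
            have hlt : #(Option (Iio i)) < ν := by
              rw [mk_option]
              refine add_lt_of_lt hν₀ ?_ (one_lt_aleph0.trans_le hν₀)
              simpa using mk_Iio_lt i
            obtain ⟨x, hx⟩ := ih _ hlt (hlt.trans (hν ▸ hι)) (fun o => o.elim (F (e i)) p) rfl
            exact ⟨x, fun j => hx (some j), hx none⟩
      have hmono : ∀ i j, i ≤ j → LeAbove L θ (h i) (h j) := fun i j hij => by
        obtain rfl | hij := hij.eq_or_lt
        · exact .refl _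
        · exact (hh j).1 ⟨i, hij⟩
      suffices ∃ g, ∀ i, LeAbove L θ (h i) g by
        obtain ⟨g, hg⟩ := this
        refine ⟨g, fun i => ?_⟩
        have := (hh (e.symm i)).2
        rw [e.apply_symm_apply] at this
        exact this.trans (hg _)
      obtain hcof | hcof := le_or_gt (Order.cof ν.ord.ToType) (chainCard T)
      · obtain ⟨S, hS, hSc⟩ := exists_cof_eq ν.ord.ToType
        have hlt : #S < ν := hSc ▸ hcof.trans_lt hκ
        obtain ⟨g, hg⟩ := ih _ hlt (hlt.trans (hν ▸ hι)) (fun s : S => h s) rfl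
        refine ⟨g, fun i => ?_⟩
        obtain ⟨s, hs, his⟩ := hS i
        exact (hmono _ _ his).trans (hg ⟨s, hs⟩)
      · exact exists_leAbove_bound_of_chain hbig hcof (by simpa [← hν] using hι) h hmono

/-- For every `θ` there are `θ` functions that are cofinal at once in all ultraproducts of
cofinality `θ`. If a family fails for `U`, enlarge it so that it becomes cofinal modulo `U` and
every member exceeds a witness of the failure. After `chainCard T` steps let `h` bound all
witnesses; then, for one index `ξ`, the sets of those `t` where `h t` is at most the value at `t` of
the `ξ`-th member would grow at every step. -/
theorem exists_universal (hbig : ∀ t, #T < Order.cof (L t)) (hθ : θ.IsRegular) :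
    ∃ k : θ.ord.ToType → ∀ t, L t, ∀ U : Ultrafilter T, ucof L U = θ →
      ∀ g : ∀ t, L t, ∃ i, ∀ᶠ t in U, g t ≤ k i t := by
  obtain hκ | hκ := le_or_gt θ (chainCard T)
  · have hev : ∀ U : Ultrafilter T, ucof L U = θ → ∀ᶠ t in U, Order.cof (L t) = θ := fun U =>
      eventually_cof_eq_of_ucof_eq hbig (hκ.trans chainCard_lt_guessCard.le)
    by_cases hT : #T < θ
    · obtain ⟨k, hk⟩ := exists_cofinal_of_cof_eq (L := L) hθ hT
      refine ⟨k, fun U hU g => ?_⟩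
      obtain ⟨i, hi⟩ := hk g
      exact ⟨i, (hev U hU).mono hi⟩
    · refine ⟨fun _ _ => Classical.arbitrary _, fun U hU => ?_⟩
      obtain ⟨t, rfl⟩ := (hev U hU).exists
      exact (hT (hbig t)).elim
  by_contra! hcon
  choose U hU w hw using hcon
  have hscale : ∀ f : θ.ord.ToType → ∀ t, L t, ∃ k : θ.ord.ToType → ∀ t, L t,
      (∀ i j, i ≤ j → ∀ᶠ t in U f, k i t ≤ k j t) ∧
        ∀ g : ∀ t, L t, ∃ i, ∀ᶠ t in U f, g t ≤ k i t := fun f => by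
    have := exists_ucof_scale (L := L) (U := U f)
    rwa [hU f] at this
  choose k hk hk' using hscale
  have hG : ∀ f, ∀ᶠ t in U f, chainCard T < Order.cof (L t) := fun f =>
    eventually_lt_cof_of_lt_ucof hbig chainCard_lt_guessCard.le (hκ.trans_eq (hU f).symm)
  obtain ⟨f, hf⟩ := exists_forall_restrict
    (fun (α : (chainCard T).ord.ToType) (p : Iio α → θ.ord.ToType → ∀ t, L t) x =>
      ∀ ξ t, chainCard T < Order.cof (L t) → ∀ β,
        max (p β ξ t) (max (w (p β) t) (k (p β) ξ t)) < x ξ t) fun α p => by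
        have := fun ξ => exists_pointwise_bound fun β t =>
          max (p β ξ t) (max (w (p β) t) (k (p β) ξ t))
        choose x hx using this
        refine ⟨x, fun ξ t ht => hx ξ t (lt_trans ?_ ht)⟩
        simpa using mk_Iio_lt α
  obtain ⟨h, hh⟩ := exists_pointwise_bound fun α => w (f α)
  have hh' : ∀ t, chainCard T < Order.cof (L t) → ∀ α, w (f α) t < h t := fun t ht =>
    hh t (by simpa using ht)
  choose s hs using fun α => hk' (f α) h
  have hθc := cof_toType_ord_of_isRegular hθ
  have hκc := cof_toType_ord_of_isRegular (isRegular_chainCard (T := T))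
  obtain ⟨ξ, hξ⟩ := exists_forall_range_lt_of_mk_lt_cof s (by simpa [hθc] using hκ)
  let B : (chainCard T).ord.ToType → Set T := fun α =>
    {t | chainCard T < Order.cof (L t) ∧ h t ≤ f α ξ t}
  obtain ⟨a, ha⟩ := exists_forall_ge_eq_of_monotone (hκc.symm ▸ mk_lt_chainCard) B
    fun α β hαβ t ht => by
      obtain rfl | hαβ := hαβ.eq_or_lt
      · exact ht
      · exact ⟨ht.1, ht.2.trans ((le_max_left _ _).trans_lt (hf β ξ t ht.1 ⟨α, hαβ⟩)).le⟩
  have := noMaxOrder_toType_ord (isRegular_chainCard (T := T)).aleph0_le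
  obtain ⟨b, hab⟩ := exists_gt a
  have hmem : ∀ᶠ t in U (f a), t ∈ B a := by
    rw [← ha b hab.le]
    filter_upwards [hG (f a), hs a, hk (f a) _ _ (hξ a).le] with t h₁ h₂ h₃
    refine ⟨h₁, (h₂.trans h₃).trans (le_trans ?_ (hf b ξ t h₁ ⟨a, hab⟩).le)⟩
    exact (le_max_right _ _).trans (le_max_right _ _)
  obtain ⟨t, ⟨h₁, h₂⟩, h₃⟩ := (hmem.and (hw (f a) ξ)).exists
  exact h₃.not_ge ((hh' t h₁ a).le.trans h₂)

end Directed

/-! ### Generators -/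

section Generators

variable {T : Type u} {L : T → Type u} [∀ t, LinearOrder (L t)] [∀ t, NoMaxOrder (L t)]
  [∀ t, Nonempty (L t)] {θ : Cardinal.{u}}

/-- An increasing universal sequence for `θ`, which moreover, at every `δ` in which the ladder
`e δ` is contained, bounds pointwise the functions with index on the ladder, as long as the factors
have cofinality above `guessCard T`. -/
theorem exists_universal_scale (hbig : ∀ t, #T < Order.cof (L t)) (hθ : θ.IsRegular)
    (e : θ.ord.ToType → (guessCard T).ord.ToType → θ.ord.ToType) :
    ∃ f : θ.ord.ToType → ∀ t, L t, (∀ i j, i ≤ j → LeAbove L θ (f i) (f j)) ∧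
      (∀ U : Ultrafilter T, ucof L U = θ → ∀ g : ∀ t, L t, ∃ i, ∀ᶠ t in U, g t ≤ f i t) ∧
      ∀ δ i, e δ i < δ → ∀ t, guessCard T < Order.cof (L t) → f (e δ i) t ≤ f δ t := by
  obtain ⟨k, hk⟩ := exists_universal hbig hθ
  obtain ⟨f, hf⟩ := exists_forall_restrict
    (fun (δ : θ.ord.ToType) (p : Iio δ → ∀ t, L t) x => (∀ j, LeAbove L θ (p j) x) ∧
      LeAbove L θ (k δ) x ∧ ∀ i, ∀ h : e δ i < δ, ∀ t, guessCard T < Order.cof (L t) →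
        p ⟨e δ i, h⟩ t ≤ x t) fun δ p => by
      obtain ⟨b, hb⟩ := exists_leAbove_bound (θ := θ) hbig (ι := Option (Iio δ)) (by
        rw [mk_option]
        refine add_lt_of_lt hθ.aleph0_le ?_ (one_lt_aleph0.trans_le hθ.aleph0_le)
        simpa using mk_Iio_lt δ) fun o => o.elim (k δ) p
      obtain ⟨c, hc⟩ := exists_pointwise_bound fun i t =>
        if h : e δ i < δ then p ⟨e δ i, h⟩ t else b t
      have hbx : LeAbove L θ b fun t => max (b t) (c t) :=
        fun U hU => Eventually.of_forall fun t => le_max_left _ _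
      refine ⟨fun t => max (b t) (c t), fun j => (hb (some j)).trans hbx, (hb none).trans hbx,
        fun i h t ht => ?_⟩
      have := hc t (by simpa using ht) i
      rw [dif_pos h] at this
      exact this.le.trans (le_max_right _ _)
  refine ⟨f, fun i j hij => ?_, fun U hU g => ?_, fun δ i h => (hf δ).2.2 i h⟩
  · obtain rfl | hij := hij.eq_or_lt
    · exact .refl _
    · exact (hf j).1 ⟨i, hij⟩
  · obtain ⟨i, hi⟩ := hk U hU g
    refine ⟨i, ?_⟩
    filter_upwards [hi, (hf i).2.1 U hU.ge] with t using le_trans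

/-- A generator for `θ`: a set that belongs to every ultrafilter whose ultraproduct has
cofinality `θ`, and to none whose ultraproduct has larger cofinality.

Take a universal sequence `f` that bounds its initial segments along ladders, and a bound `g₀` of
`f` modulo all ultrafilters of cofinality above `θ`. Each set `E ξ = {t | g₀ t < f ξ t}` avoids the
latter ultrafilters, and each ultrafilter of cofinality `θ` contains some `E ξ`. If no `E ξ` is a
generator, then the `E ξ` grow properly. Along a suitable normal function `ξ` from `guessCard T` to
`θ`, club guessing yields a set `𝒞 α` of indices such that the initial segments of
`(f (ξ ζ))` for `ζ ∈ 𝒞 α` are bounded by later `f (ξ j)`, jointly off one small set. But all `t`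
that ever enter `E (ξ ζ)` for some `ζ ∈ 𝒞 α` do so before some `j ∈ 𝒞 α`, as `𝒞 α` is long, so that
the sets `E (ξ ζ)` stop growing at `j`. -/
theorem exists_generator (hbig : ∀ t, #T < Order.cof (L t)) (hθ : θ.IsRegular) :
    ∃ B : Set T, ∀ U : Ultrafilter T, (ucof L U = θ → B ∈ U) ∧ (B ∈ U → ucof L U ≤ θ) := by
  obtain hμ | hμ := le_or_gt θ (guessCard T)
  · exact ⟨{t | Order.cof (L t) = θ}, fun U => ⟨eventually_cof_eq_of_ucof_eq hbig hμ,
      fun h => (ucof_eq_of_eventually_cof_eq hbig h).le⟩⟩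
  have hθc := cof_toType_ord_of_isRegular hθ
  have hMc := cof_toType_ord_of_isRegular (isRegular_guessCard (T := T))
  have := nonempty_toType_ord hθ.aleph0_le
  have := nonempty_toType_ord (isRegular_guessCard (T := T)).aleph0_le
  have := noMaxOrder_toType_ord (isRegular_guessCard (T := T)).aleph0_le
  obtain ⟨𝒞, h𝒞⟩ := exists_clubGuessing (isRegular_chainCard (T := T)) aleph0_lt_chainCard
    isRegular_guessCard succ_chainCard_lt_guessCard
  let ladder : θ.ord.ToType → ((guessCard T).ord.ToType → θ.ord.ToType) → Prop := fun δ e =>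
    IsNormal e ∧ IsLUB (range e) δ
  obtain ⟨e, he⟩ : ∃ e : θ.ord.ToType → (guessCard T).ord.ToType → θ.ord.ToType,
      ∀ δ, (∃ e', ladder δ e') → ladder δ (e δ) :=
    ⟨fun δ => Classical.epsilon (ladder δ), fun δ h => Classical.epsilon_spec h⟩
  obtain ⟨f, hmono, huniv, hladder⟩ := exists_universal_scale hbig hθ e
  obtain ⟨g₀, hg₀⟩ := exists_leAbove_bound (θ := succ θ) hbig (by simp) f
  let E : θ.ord.ToType → Set T := fun ξ => {t | g₀ t < f ξ t}
  have hE : ∀ ξ (U : Ultrafilter T), E ξ ∈ U → ucof L U ≤ θ := fun ξ U h => by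
    by_contra! hlt
    obtain ⟨t, h₁, h₂⟩ := ((hg₀ ξ U (succ_le_of_lt hlt)).and h).exists
    exact h₁.not_gt h₂
  by_contra hcon
  have hgrow : ∀ ξ, ∃ ξ', ∃ U : Ultrafilter T, θ ≤ ucof L U ∧ E ξ' ∈ U ∧ E ξ ∉ U := fun ξ => by
    by_contra! hstay
    refine hcon ⟨E ξ, fun U => ⟨fun hU => ?_, hE ξ U⟩⟩
    choose g₁ hg₁ using fun t => exists_gt (g₀ t)
    obtain ⟨i, hi⟩ := huniv U hU g₁
    refine hstay i U hU.ge ?_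
    filter_upwards [hi] with t ht using (hg₁ t).trans_le ht
  choose next V hV hnext hnext' using hgrow
  -- `joint S σ`: off a set in `J_{<θ}`, the function `f σ` bounds all `f x`, `x ∈ S`, at once.
  let joint : Set θ.ord.ToType → θ.ord.ToType → Prop := fun S σ =>
    ∀ U : Ultrafilter T, θ ≤ ucof L U → ∀ᶠ t in U, ∀ x ∈ S, f x t ≤ f σ t
  obtain ⟨σ, hσ⟩ : ∃ σ : Set θ.ord.ToType → θ.ord.ToType, ∀ S, (∃ x, joint S x) → joint S (σ S) :=
    ⟨fun S => Classical.epsilon (joint S), fun S h => Classical.epsilon_spec h⟩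
  choose bd hbd using fun F : (guessCard T).ord.ToType → θ.ord.ToType =>
    exists_forall_range_lt_of_mk_lt_cof F (by simpa [hθc] using hμ)
  obtain ⟨ξ, hξ, hξQ⟩ := exists_isNormal_forall_lt_succ (M := (guessCard T).ord.ToType)
    (X := θ.ord.ToType) (fun i => by
      rw [hθc]
      refine lt_trans ?_ hμ
      simpa using mk_Iio_lt i)
    (fun j ξ => max (next (ξ j)) (bd fun α => σ (ξ '' (𝒞 α ∩ Iic j)))) fun j g g' h => by
      have : ∀ α, g '' (𝒞 α ∩ Iic j) = g' '' (𝒞 α ∩ Iic j) := fun α =>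
        image_congr fun i hi => h i hi.2
      simp only [h j le_rfl, this]
  have hlater : ∀ {i j}, i < j → max (next (ξ i)) (bd fun α => σ (ξ '' (𝒞 α ∩ Iic i))) < ξ j :=
    fun {i j} hij => (hξQ i).trans_le (hξ.monotone (succ_le_of_lt hij))
  obtain ⟨δ, hδ⟩ := exists_isLUB_range_of_mk_lt_cof ξ (by simpa [hθc] using hμ)
  obtain ⟨hen, heδ⟩ := he δ ⟨ξ, hξ, hδ⟩
  have hagree := isClub_setOf_eq_of_isNormal
    (by rw [hMc]; exact aleph0_lt_chainCard.trans chainCard_lt_guessCard) hξ hen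
    (exists_le_of_isLUB_range hξ.strictMono hδ heδ)
    (exists_le_of_isLUB_range hen.strictMono heδ hδ)
  obtain ⟨α, hα, hlong⟩ := h𝒞 _ hagree
  have hjoint : ∀ i j, i < j → joint (ξ '' (𝒞 α ∩ Iic i)) (ξ j) := fun i j hij U hU => by
    have h₁ : joint (ξ '' (𝒞 α ∩ Iic i)) δ := by
      intro U hU
      filter_upwards [eventually_lt_cof_of_lt_ucof hbig le_rfl (hμ.trans_le hU)] with t ht
      rintro _ ⟨ζ, hζ, rfl⟩
      have hζe : ξ ζ = e δ ζ := hα hζ.1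
      obtain ⟨ζ', hζ'⟩ := exists_gt ζ
      rw [hζe]
      exact hladder δ ζ ((hen.strictMono hζ').trans_le (heδ.1 ⟨ζ', rfl⟩)) t ht
    have h₂ : σ (ξ '' (𝒞 α ∩ Iic i)) ≤ ξ j :=
      (((hbd _ α).trans_le (le_max_right _ _)).trans (hlater hij)).le
    filter_upwards [hσ _ ⟨δ, h₁⟩ U hU, hmono _ _ h₂ U hU] with t h₃ h₄ x hx
    exact (h₃ x hx).trans h₄
  -- The stage at which `t` enters one of the sets `E (ξ ζ)`, `ζ ∈ 𝒞 α`, if it ever does.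
  choose z hz hz' using fun t : {t // ∃ ζ ∈ 𝒞 α, t ∈ E (ξ ζ)} => t.2
  obtain ⟨i, hi, hzi⟩ := hlong (range z) (by rintro _ ⟨t, rfl⟩; exact hz t)
    ((mk_range_le.trans (mk_subtype_le _)).trans_lt mk_lt_chainCard)
  have hsingle : ∀ i ∈ 𝒞 α, ∃ j ∈ 𝒞 α, i < j := fun i hi => by
    obtain ⟨j, hj, hij⟩ := hlong {i} (by simpa using hi)
      (by simpa using one_lt_aleph0.trans aleph0_lt_chainCard)
    exact ⟨j, hj, hij i rfl⟩
  obtain ⟨j, hj, hij⟩ := hsingle i hi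
  obtain ⟨j', hj', hjj'⟩ := hsingle j hj
  refine hnext' (ξ j) ?_
  have hle : next (ξ j) ≤ ξ j' := ((le_max_left _ _).trans_lt (hlater hjj')).le
  filter_upwards [hnext (ξ j), hmono _ _ hle _ (hV (ξ j)), hjoint i j hij _ (hV (ξ j))]
    with t h₁ h₂ h₃
  have ht : ∃ ζ ∈ 𝒞 α, t ∈ E (ξ ζ) := ⟨j', hj', lt_of_lt_of_le h₁ h₂⟩
  exact lt_of_lt_of_le (hz' ⟨t, ht⟩) (h₃ _ ⟨_, ⟨hz _, (hzi _ ⟨_, rfl⟩).le⟩, rfl⟩)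

end Generators

/-! ### Dependence on the cofinalities of the factors -/

section ChangeOfFactors

variable {T : Type u} {L : T → Type u} [∀ t, LinearOrder (L t)]

theorem cof_eq_of_monotone_of_cofinal {X Y : Type u} [Preorder X] [Preorder Y] {φ : Y → X}
    {ψ : X → Y} (hφ : Monotone φ) (hcof : ∀ x, ∃ y, x ≤ φ y) (hψ : ∀ x y, φ y ≤ x → y ≤ ψ x) :
    Order.cof X = Order.cof Y := by
  refine le_antisymm (le_cof_iff.2 fun S hS => ?_) (le_cof_iff.2 fun S hS => ?_)
  · refine (cof_le (s := φ '' S) fun x => ?_).trans mk_image_le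
    obtain ⟨y, hy⟩ := hcof x
    obtain ⟨s, hs, hys⟩ := hS y
    exact ⟨φ s, ⟨s, hs, rfl⟩, hy.trans (hφ hys)⟩
  · refine (cof_le (s := ψ '' S) fun y => ?_).trans mk_image_le
    obtain ⟨s, hs, hys⟩ := hS (φ y)
    exact ⟨ψ s, ⟨s, hs, rfl⟩, hψ _ _ hys⟩

theorem ucof_eq_ucof_carrier [∀ t, NoMaxOrder (L t)] [∀ t, Nonempty (L t)] (U : Ultrafilter T) :
    ucof L U = ucof (fun t => Carrier (Order.cof (L t))) U := by
  choose k hk hk' using fun t => exists_monotone_cofinal (X := L t) le_total aleph0_le_cof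
  have hψ : ∀ t (x : L t), ∃ y : Carrier (Order.cof (L t)), ∀ z, k t z ≤ x → z ≤ y := fun t x => by
    obtain ⟨x', hx'⟩ := exists_gt x
    obtain ⟨y, hy⟩ := hk' t x'
    refine ⟨y, fun z hz => le_of_not_gt fun hyz => ?_⟩
    exact (hx'.trans_le (hy.trans ((hk t hyz.le).trans hz))).false
  choose ψ hψ using hψ
  refine cof_eq_of_monotone_of_cofinal (X := UProd L U)
    (Y := UProd (fun t => Carrier (Order.cof (L t))) U)
    (φ := fun h t => k t (h t)) (ψ := fun f t => ψ t (f t)) (fun h h' hh => ?_) (fun f => ?_)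
    fun f h hfh => ?_
  · have hh : ∀ᶠ t in U, h t ≤ h' t := hh
    exact hh.mono fun t ht => hk t ht
  · choose y hy using fun t => hk' t (f t)
    exact ⟨y, Eventually.of_forall hy⟩
  · have hfh : ∀ᶠ t in U, k t (h t) ≤ f t := hfh
    exact hfh.mono fun t ht => hψ t _ _ ht

/-- The cofinality of an ultraproduct depends only on the cofinalities of the factors. -/
theorem ucof_congr {L' : T → Type u} [∀ t, LinearOrder (L' t)]
    [∀ t, NoMaxOrder (L t)] [∀ t, Nonempty (L t)] [∀ t, NoMaxOrder (L' t)] [∀ t, Nonempty (L' t)]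
    (h : ∀ t, Order.cof (L t) = Order.cof (L' t)) (U : Ultrafilter T) :
    ucof L U = ucof L' U := by
  rw [ucof_eq_ucof_carrier, ucof_eq_ucof_carrier (L := L')]
  exact congrArg (fun lam : T → Cardinal.{u} => ucof (fun t => Carrier (lam t)) U) (funext h)

variable [∀ t, NoMaxOrder (L t)] [∀ t, Nonempty (L t)]

theorem ucof_le_ucof_map (hbig : ∀ t, #T < Order.cof (L t)) {σ : T → T}
    (hσ : ∀ t, Order.cof (L (σ t)) = Order.cof (L t)) (U : Ultrafilter T) :
    ucof L U ≤ ucof L (U.map σ) := by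
  rw [← ucof_congr hσ U]
  refine le_cof_iff.2 fun S hS => ?_
  refine (cof_le (α := UProd (fun t => L (σ t)) U) (s := (fun f t => f (σ t)) '' S)
    fun g => ?_).trans mk_image_le
  have h : ∀ s, ∃ x : L s, ∀ t (hts : σ t = s), hts ▸ g t < x := fun s => by
    obtain ⟨x, hx⟩ := exists_forall_range_lt_of_mk_lt_cof
      (fun p : {t // σ t = s} => (p.2 ▸ g p.1 : L s)) ((mk_subtype_le _).trans_lt (hbig s))
    exact ⟨x, fun t ht => hx ⟨t, ht⟩⟩
  choose h hh using h
  obtain ⟨f, hf, hhf⟩ := hS h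
  have hhf : ∀ᶠ t in U, h (σ t) ≤ f (σ t) := hhf
  refine ⟨_, ⟨f, hf, rfl⟩, ?_⟩
  change ∀ᶠ t in U, g t ≤ f (σ t)
  filter_upwards [hhf] with t ht using (hh _ t rfl).le.trans ht

/-- Generators can be chosen to depend only on the cofinalities of the factors: saturating a
generator adds no ultrafilters that matter, since an ultrafilter containing the saturation can be
moved into the generator along a map that preserves the cofinalities of the factors. -/
theorem exists_saturated_generator {θ : Cardinal.{u}} (hbig : ∀ t, #T < Order.cof (L t))
    (hθ : θ.IsRegular) :
    ∃ b ⊆ range fun t => Order.cof (L t), ∀ U : Ultrafilter T,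
      (ucof L U = θ → {t | Order.cof (L t) ∈ b} ∈ U) ∧
        ({t | Order.cof (L t) ∈ b} ∈ U → ucof L U ≤ θ) := by
  classical
  obtain ⟨B, hB⟩ := exists_generator hbig hθ
  refine ⟨(fun t => Order.cof (L t)) '' B, image_subset_range _ _, fun U => ⟨fun h => ?_,
    fun h => ?_⟩⟩
  · exact mem_of_superset ((hB U).1 h) fun t ht => ⟨t, ht, rfl⟩
  · have hσ : ∀ t, ∃ s, Order.cof (L s) = Order.cof (L t) ∧
        (Order.cof (L t) ∈ (fun t => Order.cof (L t)) '' B → s ∈ B) := fun t => by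
      by_cases ht : Order.cof (L t) ∈ (fun t => Order.cof (L t)) '' B
      · obtain ⟨s, hs, hst⟩ := ht
        exact ⟨s, hst, fun _ => hs⟩
      · exact ⟨t, rfl, fun h => (ht h).elim⟩
    choose σ hσ hσ' using hσ
    exact (ucof_le_ucof_map hbig hσ U).trans ((hB (U.map σ)).2
      (Ultrafilter.mem_map.2 (mem_of_superset h hσ')))

end ChangeOfFactors

/-! ### The largest cofinality, and the number of cofinalities -/

section MaxPcf

variable {T : Type u} {L : T → Type u} [∀ t, LinearOrder (L t)] [∀ t, NoMaxOrder (L t)]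
  [∀ t, Nonempty (L t)]

theorem exists_ultrafilter_of_forall_finset {ι : Type*} (A : ι → Set T)
    (h : ∀ s : Finset ι, ∃ t, ∀ i ∈ s, t ∈ A i) : ∃ U : Ultrafilter T, ∀ i, A i ∈ U := by
  classical
  obtain ⟨U, hU⟩ := Ultrafilter.exists_ultrafilter_of_finite_inter_nonempty (range A) fun S hS => by
    obtain ⟨s, rfl⟩ : ∃ s : Finset ι, s.image A = S := by
      rw [← image_univ, Finset.subset_set_image_iff] at hS
      obtain ⟨s, -, hs⟩ := hS
      exact ⟨s, hs⟩
    obtain ⟨t, ht⟩ := h s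
    exact ⟨t, by simpa using ht⟩
  exact ⟨U, fun i => hU ⟨i, rfl⟩⟩

/-- Some ultraproduct has the largest cofinality. Otherwise the complements of the generators would
have the finite intersection property, and an ultrafilter containing all of them would miss the
generator for its own cofinality. -/
theorem exists_forall_ucof_le [Nonempty T] (hbig : ∀ t, #T < Order.cof (L t)) :
    ∃ U₀ : Ultrafilter T, ∀ U : Ultrafilter T, ucof L U ≤ ucof L U₀ := by
  by_contra! hcon
  choose B hB using fun V : Ultrafilter T =>
    exists_generator hbig (isRegular_ucof (L := L) (U := V))
  obtain ⟨U, hU⟩ := exists_ultrafilter_of_forall_finset (fun V => (B V)ᶜ) fun s => by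
    obtain ⟨W, hW⟩ : ∃ W : Ultrafilter T, ∀ V ∈ s, ucof L V < ucof L W := by
      obtain rfl | hs := s.eq_empty_or_nonempty
      · exact ⟨pure (Classical.arbitrary T), by simp⟩
      · obtain ⟨V, -, hV⟩ := s.exists_max_image (ucof L) hs
        obtain ⟨W, hW⟩ := hcon V
        exact ⟨W, fun V' hV' => (hV V' hV').trans_lt hW⟩
    have hmem : ∀ᶠ t in W, ∀ V ∈ s, t ∈ (B V)ᶜ := by
      rw [eventually_all_finset]
      exact fun V hV => Ultrafilter.compl_mem_iff_notMem.2 fun h =>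
        ((hB V W).2 h).not_gt (hW V hV)
    exact hmem.exists
  exact Ultrafilter.compl_mem_iff_notMem.1 (hU U) ((hB U U).1 rfl)

/-- Finite suprema of members of universal families are cofinal in the full product: a function that
no such supremum bounds lies strictly above all the families modulo one ultrafilter. -/
theorem cof_pi_eq_of_forall_ucof_le (hbig : ∀ t, #T < Order.cof (L t)) {U₀ : Ultrafilter T}
    (hU₀ : ∀ U : Ultrafilter T, ucof L U ≤ ucof L U₀) : Order.cof (∀ t, L t) = ucof L U₀ := by
  refine le_antisymm ?_ (le_cof_iff.2 fun S hS => ?_)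
  · set m := ucof L U₀
    have hm₀ : ℵ₀ ≤ m := aleph0_le_ucof
    have huniv : ∀ θ : Cardinal.{u}, ∃ k : θ.ord.ToType → ∀ t, L t, ∀ U : Ultrafilter T,
        ucof L U = θ → ∀ g : ∀ t, L t, ∃ i, ∀ᶠ t in U, g t ≤ k i t := fun θ => by
      by_cases hθ : θ.IsRegular
      · exact exists_universal hbig hθ
      · exact ⟨fun _ _ => Classical.arbitrary _, fun U hU => (hθ (hU ▸ isRegular_ucof)).elim⟩
    choose k hk using huniv
    let ι : Type u := Σ o : (m.ord + 1).ToType, (o.toOrd : Ordinal.{u}).card.ord.ToType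
    have hι : #ι ≤ m := by
      rw [mk_sigma]
      refine (sum_le_sum _ (fun _ => m) fun o => ?_).trans ?_
      · rw [mk_toType, card_ord]
        exact (Ordinal.card_le_card (lt_add_one_iff.1 o.toOrd.2)).trans_eq (card_ord m)
      · rw [sum_const', mk_toType, Ordinal.card_add_one, card_ord, add_one_eq hm₀, mul_eq_self hm₀]
    have hbound : ∀ l : List ι, ∃ b : ∀ t, L t, ∀ p ∈ l, ∀ t, k _ p.2 t ≤ b t := fun l => by
      obtain ⟨b, hb⟩ := exists_pointwise_bound (L := L) fun p : ULift.{u} (Fin l.length) =>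
        k _ (l.get p.down).2
      refine ⟨b, fun p hp t => ?_⟩
      obtain ⟨i, rfl⟩ := List.get_of_mem hp
      refine (hb t ?_ ⟨i⟩).le
      exact (lt_aleph0_of_finite _).trans_le aleph0_le_cof
    choose b hb using hbound
    refine (cof_le (s := range b) fun g => ?_).trans
      (mk_range_le.trans ((mk_list_le_max ι).trans (max_le hm₀ hι)))
    by_contra! hcon
    obtain ⟨U, hU⟩ := exists_ultrafilter_of_forall_finset
      (fun p : ι => {t | k _ p.2 t < g t}) fun s => by
        by_contra! hs
        refine hcon (b s.toList) ⟨_, rfl⟩ fun t => ?_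
        obtain ⟨p, hp, hpt⟩ := hs t
        exact (not_lt.1 hpt).trans (hb _ p (by simpa using hp) t)
    have ho : (ucof L U).ord < m.ord + 1 := lt_add_one_iff.2 (ord_le_ord.2 (hU₀ U))
    have hcard : ucof L U =
        ((Ordinal.ToType.mk ⟨_, ho⟩ : (m.ord + 1).ToType).toOrd : Ordinal.{u}).card := by simp
    obtain ⟨i, hi⟩ := hk _ U hcard g
    obtain ⟨t, h₁, h₂⟩ := (hi.and (hU ⟨Ordinal.ToType.mk ⟨_, ho⟩, i⟩)).exists
    exact h₁.not_gt h₂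
  · refine cof_le (α := UProd L U₀) (s := S) fun g => ?_
    obtain ⟨f, hf, hgf⟩ := hS g
    exact ⟨f, hf, Eventually.of_forall hgf⟩

/-- There are at most `2 ^ #T` cofinalities of ultraproducts, as distinct ones have distinct
generators. -/
theorem mk_range_ucof_le (hbig : ∀ t, #T < Order.cof (L t)) :
    #(range (ucof L)) ≤ Cardinal.lift.{u + 1} ((2 : Cardinal.{u}) ^ #T) := by
  choose B hB using fun θ : range (ucof L) => exists_generator hbig (θ := θ) (by
    obtain ⟨U, hU⟩ := θ.2
    rw [← hU]
    exact isRegular_ucof)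
  have hinj : Function.Injective B := fun θ θ' h => by
    have hle : ∀ {θ θ'}, B θ = B θ' → θ ≤ θ' := fun {θ θ'} h => by
      obtain ⟨U, hU⟩ := θ.2
      have := (hB θ' U).2 (h ▸ (hB θ U).1 hU)
      rwa [hU] at this
    exact le_antisymm (hle h) (hle h.symm)
  have := mk_le_of_injective (Equiv.ulift.{u + 1}.symm.injective.comp hinj)
  rw [mk_uLift, mk_set] at this
  exact this

end MaxPcf

/-! ### Maximal ideals and ultrafilters -/

section Ideals

variable {T : Type u}

/-- The ultrafilter of complements of members of a maximal ideal of subsets. -/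
def ultrafilterOfIdeal (I : Order.Ideal (Set T)) [I.IsMaximal] : Ultrafilter T :=
  .ofComplNotMemIff
    { sets := {A | Aᶜ ∈ I}
      univ_sets := by simpa using Order.Ideal.bot_mem I
      sets_of_superset := fun hA h => I.lower (compl_subset_compl.2 h) hA
      inter_sets := fun hA hB => by
        rw [mem_ofPred_eq, compl_inter]
        exact Order.Ideal.sup_mem hA hB }
    fun A => by
      change Aᶜᶜ ∉ I ↔ Aᶜ ∈ I
      rw [compl_compl]
      refine ⟨(Order.Ideal.IsPrime.mem_or_compl_mem (I := I) inferInstance).resolve_left,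
        fun h h' => ?_⟩
      refine Order.Ideal.IsProper.top_notMem (I := I) inferInstance ?_
      have : A ∪ Aᶜ ∈ I := Order.Ideal.sup_mem h' h
      rwa [union_compl_self] at this

theorem mem_ultrafilterOfIdeal {I : Order.Ideal (Set T)} [I.IsMaximal] {A : Set T} :
    A ∈ ultrafilterOfIdeal I ↔ A ∉ I :=
  (Ultrafilter.compl_notMem_iff (f := ultrafilterOfIdeal I)).symm.trans <| by
    change Aᶜᶜ ∉ I ↔ A ∉ I
    rw [compl_compl]

theorem exists_ultrafilterOfIdeal_eq (U : Ultrafilter T) :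
    ∃ (I : Order.Ideal (Set T)) (_ : I.IsMaximal), ultrafilterOfIdeal I = U := by
  let I : Order.Ideal (Set T) :=
    { carrier := {A | A ∉ U}
      lower' := fun A B h hA hB => hA (mem_of_superset hB h)
      nonempty' := ⟨∅, Ultrafilter.empty_notMem⟩
      directed' := fun A hA B hB => ⟨A ∪ B, fun h => (Ultrafilter.union_mem_iff.1 h).elim hA hB,
        subset_union_left, subset_union_right⟩ }
  have hmem : ∀ {A}, A ∈ I ↔ A ∉ U := Iff.rfl
  have : I.IsProper := Order.Ideal.isProper_of_notMem (p := univ) fun h => h univ_mem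
  have : I.IsPrime := Order.Ideal.isPrime_of_mem_or_compl_mem fun {A} => by
    rw [hmem, hmem, Ultrafilter.compl_notMem_iff]
    exact (em _).symm
  refine ⟨I, inferInstance, Ultrafilter.ext fun A => ?_⟩
  rw [mem_ultrafilterOfIdeal, hmem, not_not]

theorem cof_prodMod_eq_ucof {L : T → Type u} [∀ t, LinearOrder (L t)] (I : Order.Ideal (Set T))
    [I.IsMaximal] : Order.cof (ProdMod L I) = ucof L (ultrafilterOfIdeal I) := by
  refine OrderIso.cof_congr (α := ProdMod L I) (γ := UProd L (ultrafilterOfIdeal I))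
    { toEquiv := Equiv.refl _, map_rel_iff' := fun {f g} => ?_ }
  change (∀ᶠ t in ultrafilterOfIdeal I, f t ≤ g t) ↔ LtMod I f g ∨ EqMod I f g
  simp only [le_iff_lt_or_eq, Ultrafilter.eventually_or]
  have h : ∀ A : Set T, A ∈ ultrafilterOfIdeal I ↔ Aᶜ ∈ I := fun A => Iff.rfl
  exact or_congr (h _) (h _)

end Ideals

/-! ### The set `pcf` -/

section Main

variable {T : Type u}

theorem pcf_eq_range_ucof {lam : T → Cardinal.{u}} (hreg : ∀ t, (lam t).IsRegular) :
    pcf lam = range (ucof fun t => Carrier (lam t)) := by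
  have := fun t => noMaxOrder_toType_ord (hreg t).aleph0_le
  have := fun t => nonempty_toType_ord (hreg t).aleph0_le
  have hcof : ∀ t, Order.cof (Carrier (lam t)) = lam t := fun t =>
    cof_toType_ord_of_isRegular (hreg t)
  ext θ
  constructor
  · rintro ⟨L, _, I, _, hL, rfl⟩
    have hne : ∀ t, Nonempty (L t) := fun t => by
      rw [← cof_ne_zero_iff, hL]
      exact (hreg t).ne_zero
    have hmax : ∀ t, NoMaxOrder (L t) := fun t => by
      rw [← noTopOrder_iff_noMaxOrder, ← one_lt_cof_iff, hL]
      exact one_lt_aleph0.trans_le (hreg t).aleph0_le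
    refine ⟨ultrafilterOfIdeal I, ?_⟩
    rw [cof_prodMod_eq_ucof]
    exact ucof_congr (fun t => (hcof t).trans (hL t).symm) _
  · rintro ⟨U, rfl⟩
    obtain ⟨I, hI, rfl⟩ := exists_ultrafilterOfIdeal_eq U
    exact ⟨fun t => Carrier (lam t), inferInstance, I, hI, hcof, cof_prodMod_eq_ucof I⟩

end Main

end Pcf

theorem mainTheorem3 {T : Type u} [Nonempty T] (lam : T → Cardinal.{u})
    (hreg : ∀ t, (lam t).IsRegular) (hbig : ∀ t, #T < lam t) :
    -- (1)
    (∀ θ ∈ Pcf.pcf lam, θ.IsRegular) ∧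
    Set.range lam ⊆ Pcf.pcf lam ∧
    #(Pcf.pcf lam) ≤ Cardinal.lift.{u + 1} ((2 : Cardinal.{u}) ^ #T) ∧
    -- (2) and (3)
    (∃ m, IsGreatest (Pcf.pcf lam) m ∧ Order.cof (∀ t, Pcf.Carrier (lam t)) = m) ∧
    -- (4)
    ∃ b : Cardinal.{u} → Set Cardinal.{u},
      (∀ θ ∈ Pcf.pcf lam, b θ ⊆ Set.range lam) ∧
      ∀ (I : Order.Ideal (Set T)) [I.IsMaximal],
        IsLeast {θ ∈ Pcf.pcf lam | {t | lam t ∈ b θ} ∉ I}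
          (Order.cof (Pcf.ProdMod (fun t => Pcf.Carrier (lam t)) I)) := by
  have := fun t => Pcf.noMaxOrder_toType_ord (hreg t).aleph0_le
  have := fun t => Pcf.nonempty_toType_ord (hreg t).aleph0_le
  have hcof : ∀ t, Order.cof (Pcf.Carrier (lam t)) = lam t :=
    fun t => Pcf.cof_toType_ord_of_isRegular (hreg t)
  have hbig' : ∀ t, #T < Order.cof (Pcf.Carrier (lam t)) := fun t => (hbig t).trans_eq (hcof t).symm
  have hpcf := Pcf.pcf_eq_range_ucof hreg
  have hpcf_reg : ∀ θ ∈ Pcf.pcf lam, θ.IsRegular := by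
    rw [hpcf]
    rintro _ ⟨U, rfl⟩
    exact Pcf.isRegular_ucof
  refine ⟨hpcf_reg, ?_, ?_, ?_, ?_⟩
  · rw [hpcf]
    rintro _ ⟨t, rfl⟩
    -- The principal ultrafilter at `t`.
    exact ⟨pure t, Pcf.ucof_eq_of_eventually_cof_eq hbig' (hcof t)⟩
  · rw [hpcf]
    exact Pcf.mk_range_ucof_le hbig'
  · obtain ⟨U₀, hU₀⟩ := Pcf.exists_forall_ucof_le hbig'
    refine ⟨_, ⟨?_, ?_⟩, Pcf.cof_pi_eq_of_forall_ucof_le hbig' hU₀⟩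
    · rw [hpcf]
      exact ⟨U₀, rfl⟩
    · rw [hpcf]
      rintro _ ⟨U, rfl⟩
      exact hU₀ U
  · have hb : ∀ θ : Cardinal.{u}, ∃ b : Set Cardinal.{u}, θ ∈ Pcf.pcf lam → b ⊆ Set.range lam ∧
        ∀ U : Ultrafilter T,
          (Pcf.ucof (fun t => Pcf.Carrier (lam t)) U = θ → {t | lam t ∈ b} ∈ U) ∧
            ({t | lam t ∈ b} ∈ U → Pcf.ucof (fun t => Pcf.Carrier (lam t)) U ≤ θ) := fun θ => by
      by_cases hθ : θ ∈ Pcf.pcf lam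
      · obtain ⟨b, hb⟩ := Pcf.exists_saturated_generator hbig' (hpcf_reg θ hθ)
        simp only [hcof] at hb
        exact ⟨b, fun _ => hb⟩
      · exact ⟨∅, fun h => (hθ h).elim⟩
    choose b hb using hb
    refine ⟨b, fun θ hθ => (hb θ hθ).1, fun I _ => ?_⟩
    rw [Pcf.cof_prodMod_eq_ucof]
    have hmem : Pcf.ucof (fun t => Pcf.Carrier (lam t)) (Pcf.ultrafilterOfIdeal I) ∈ Pcf.pcf lam :=
      hpcf ▸ ⟨_, rfl⟩
    refine ⟨⟨hmem, ?_⟩, ?_⟩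
    · exact Pcf.mem_ultrafilterOfIdeal.1 (((hb _ hmem).2 _).1 rfl)
    · rintro θ ⟨hθ, hθI⟩
      exact ((hb θ hθ).2 _).2 (Pcf.mem_ultrafilterOfIdeal.2 hθI)
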